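/- Let $n\ge 1$, $s\in(0,1)$, $\delta>0$, and let $w_\delta:\mathbb{R}^n\to[0,\infty)$ be radial, $w_\delta=\overline w_\delta(|\cdot|)$ with $\overline w_\delta:\mathbb{R}\to[0,\infty)$, smooth with compact support in $B_\delta(0)$, equal to $1$ on $B_{\mu\delta}(0)$ for some $\mu\in(0,1)$, and radially decreasing, i.e. $w_\delta(z)\ge w_\delta(\tilde z)$ if $|z|\le|\tilde z|$. Set $$\rho_\delta^s(z)=c_{n,s,\delta}\frac{w_\delta(z)}{|z|^{n+s-1}}\quad(z\ne 0),\qquad\text{where } c_{n,s,\delta}\int_{B_\delta(0)}\frac{w_\delta(z)}{|z|^{n+s-1}}\,dz=n,$$ and for $\psi\in C_c^\infty(\mathbb{R}^n;\mathbb{R}^n)$ let $$\operatorname{div}_\delta^s\psi(x)=\int_{\mathbb{R}^n}\frac{\psi(x)-\psi(y)}{|x-y|}\cdot\frac{x-y}{|x-y|}\,\rho_\delta^s(x-y)\,dy .$$ For an open set $\Omega\subset\mathbb{R}^n$ put $\Omega_\delta=\{x\in\mathbb{R}^n:\operatorname{dist}(x,\Omega)<\delta\}$. A function $v\in L^1_{\rm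 loc}(\Omega;\mathbb{R}^n)$ is the weak nonlocal gradient $D_\delta^s u$ of $u\in L^1_{\rm loc}(\Omega_\delta)$ if $$\int_\Omega v\cdot\psi\,dx=-\int_{\Omega_\delta}u\,\operatorname{div}_\delta^s\psi\,dx\qquad\text{for all }\psi\in C_c^\infty(\Omega;\mathbb{R}^n).$$ For $p\in[1,\infty]$ let $$H^{s,p,\delta}(\Omega)=\{u\in L^p(\Omega_\delta):D_\delta^s u\in L^p(\Omega;\mathbb{R}^n)\},\qquad N^{s,p,\delta}(\Omega)=\{h\in H^{s,p,\delta}(\Omega):D_\delta^s h=0\text{ a.e. in }\Omega\}.$$ **Proposition.** Let $\Omega\subset\mathbb{R}^n$ be a bounded open set (for instance a bounded Lipschitz domain) and let $p\in[1,\infty]$. Then for every nonempty open set $U\subset\Omega$, $$N^{s,p,\delta}(\Omega)\not\subset\{u\in H^{s,p,\delta}(\Omega): u\text{ is constant a.e. on }U\}.$$ -/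

import Mathlib

open MeasureTheory

open scoped ENNReal

namespace NonlocalGradient

/-- The hypotheses on the cut-off function `w : ℝⁿ → [0, ∞)` with horizon `δ`: it is radial with
nonnegative profile, smooth, compactly supported in the open ball `B_δ(0)`, equal to `1` on
`B_{μδ}(0)` for some `μ ∈ (0, 1)`, and radially decreasing. -/
structure IsCutoff {n : ℕ} (δ : ℝ) (w : EuclideanSpace ℝ (Fin n) → ℝ) : Prop where
  radial : ∃ wbar : ℝ → ℝ, (∀ r, 0 ≤ wbar r) ∧ ∀ z, w z = wbar ‖z‖
  smooth : ContDiff ℝ ((⊤ : ℕ∞) : WithTop ℕ∞) w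
  hasCompactSupport : HasCompactSupport w
  tsupport_subset : tsupport w ⊆ Metric.ball 0 δ
  normalized : ∃ μ : ℝ, 0 < μ ∧ μ < 1 ∧ ∀ z ∈ Metric.ball (0 : EuclideanSpace ℝ (Fin n)) (μ * δ),
    w z = 1
  decreasing : ∀ z z', ‖z‖ ≤ ‖z'‖ → w z' ≤ w z

/-- The scaling constant `c`, determined by `c * ∫_{B_δ(0)} w(z) / |z|^(n+s-1) dz = n`.
(For a cut-off `w` and `n ≥ 1`, `0 < s < 1`, `0 < δ`, the integral is finite and positive.) -/
noncomputable def scalingConst {n : ℕ} (s δ : ℝ) (w : EuclideanSpace ℝ (Fin n) → ℝ) : ℝ :=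
  (n : ℝ) / ∫ z in Metric.ball (0 : EuclideanSpace ℝ (Fin n)) δ, w z / ‖z‖ ^ ((n : ℝ) + s - 1)

/-- The kernel `ρ(z) = c * w(z) / |z|^(n+s-1)`. -/
noncomputable def kernel {n : ℕ} (s δ : ℝ) (w : EuclideanSpace ℝ (Fin n) → ℝ)
    (z : EuclideanSpace ℝ (Fin n)) : ℝ :=
  scalingConst s δ w * w z / ‖z‖ ^ ((n : ℝ) + s - 1)

/-- The nonlocal divergence
`∫ (ψ(x) - ψ(y)) / |x - y| · (x - y) / |x - y| * ρ(x - y) dy` of a vector field `ψ`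
(the integral converges absolutely for `ψ ∈ C_c^∞`). -/
noncomputable def nonlocalDiv {n : ℕ} (s δ : ℝ) (w : EuclideanSpace ℝ (Fin n) → ℝ)
    (ψ : EuclideanSpace ℝ (Fin n) → EuclideanSpace ℝ (Fin n)) (x : EuclideanSpace ℝ (Fin n)) : ℝ :=
  ∫ y, inner ℝ (‖x - y‖⁻¹ • (ψ x - ψ y)) (‖x - y‖⁻¹ • (x - y)) * kernel s δ w (x - y)

/-- `v ∈ L¹_loc(Ω; ℝⁿ)` is the weak nonlocal gradient of `u ∈ L¹_loc(Ω_δ)`, where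
`Ω_δ = {x | dist(x, Ω) < δ}`, i.e. `∫_Ω v · ψ = - ∫_{Ω_δ} u div ψ` for all `ψ ∈ C_c^∞(Ω; ℝⁿ)`.
Only the values of `u` on `Ω_δ` and of `v` on `Ω` matter. -/
structure IsWeakNonlocalGrad {n : ℕ} (s δ : ℝ) (w : EuclideanSpace ℝ (Fin n) → ℝ)
    (Ω : Set (EuclideanSpace ℝ (Fin n))) (u : EuclideanSpace ℝ (Fin n) → ℝ)
    (v : EuclideanSpace ℝ (Fin n) → EuclideanSpace ℝ (Fin n)) : Prop where
  locallyIntegrable_fun : LocallyIntegrableOn u (Metric.thickening δ Ω)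
  locallyIntegrable_grad : LocallyIntegrableOn v Ω
  integral_by_parts : ∀ ψ : EuclideanSpace ℝ (Fin n) → EuclideanSpace ℝ (Fin n),
    ContDiff ℝ ((⊤ : ℕ∞) : WithTop ℕ∞) ψ → HasCompactSupport ψ → tsupport ψ ⊆ Ω →
      ∫ x in Ω, inner ℝ (v x) (ψ x) =
        - ∫ x in Metric.thickening δ Ω, u x * nonlocalDiv s δ w ψ x

/-- The nonlocal Sobolev space `H^{s,p,δ}(Ω)`: all `u ∈ L^p(Ω_δ)` with a weak nonlocal gradient in
`L^p(Ω; ℝⁿ)`. Elements are represented by functions on `ℝⁿ`, of which only the restriction to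
`Ω_δ` (up to null sets) is relevant. -/
def nonlocalSobolev {n : ℕ} (s : ℝ) (p : ℝ≥0∞) (δ : ℝ) (w : EuclideanSpace ℝ (Fin n) → ℝ)
    (Ω : Set (EuclideanSpace ℝ (Fin n))) : Set (EuclideanSpace ℝ (Fin n) → ℝ) :=
  {u | MemLp u p (volume.restrict (Metric.thickening δ Ω)) ∧
    ∃ v, IsWeakNonlocalGrad s δ w Ω u v ∧ MemLp v p (volume.restrict Ω)}

/-- `N^{s,p,δ}(Ω)`: the functions in `H^{s,p,δ}(Ω)` whose weak nonlocal gradient vanishes a.e. in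
`Ω` (for open `Ω` the weak nonlocal gradient is unique up to null sets). -/
def zeroNonlocalGrad {n : ℕ} (s : ℝ) (p : ℝ≥0∞) (δ : ℝ) (w : EuclideanSpace ℝ (Fin n) → ℝ)
    (Ω : Set (EuclideanSpace ℝ (Fin n))) : Set (EuclideanSpace ℝ (Fin n) → ℝ) :=
  {h | h ∈ nonlocalSobolev s p δ w Ω ∧
    ∃ v, IsWeakNonlocalGrad s δ w Ω h v ∧ ∀ᵐ x ∂(volume.restrict Ω), v x = 0}

end NonlocalGradient

/-! Exponentials `exp (l⟨e, x⟩)` with `e` a unit vector are eigenfunctions: by translation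
invariance and radial symmetry, the nonlocal gradient multiplies them by a constant multiple of
`symbol κ e l` times `e`, where `κ` is `scalarKernel`. It therefore suffices to find a complex `l ≠
0` at which the symbol vanishes.

The symbol is an odd entire function of exponential type. Were 0 its only zero, `symbol κ e l / l`
would be even, zero-free and of exponential type, hence constant by a Hadamard-type argument. The
symbol would then be linear, but its derivative is strictly larger at 1 than at 0 because `cosh > 1`
off the origin (`exists_symbol_eq_zero`).

Real and imaginary parts of the exponential then have zero nonlocal gradient
(`re_exp_mem_zeroNonlocalGrad`), and they cannot both be constant on a nonempty open set. -/

/-! ### Zeros of odd entire functions of exponential type. -/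

-- A logarithm of `F` has real part of at most linear growth, so it is affine; evenness removes the
-- slope.
open Complex Metric in
theorem Complex.eq_const_of_even_of_ne_zero_of_norm_le_exp {F : ℂ → ℂ} (hF : Differentiable ℂ F)
    (heven : ∀ z, F (-z) = F z) (hne : ∀ z, F z ≠ 0) {C B : ℝ} (hB : 0 ≤ B)
    (hbound : ∀ z, ‖F z‖ ≤ C * Real.exp (B * ‖z‖)) (z : ℂ) : F z = F 0 := by
  have hC : 0 < C := by
    have := (norm_pos_iff.2 (hne 0)).trans_le (hbound 0)
    simpa using this
  have hF' : Differentiable ℂ (deriv F) := hF.deriv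
  have hq : Differentiable ℂ fun z ↦ deriv F z / F z := hF'.div hF hne
  obtain ⟨g, hg0, hg⟩ := hq.isExactOn_univ.with_val_at 0 (log (F 0))
  replace hg : ∀ z, HasDerivAt g (deriv F z / F z) z := fun z ↦ hg z trivial
  have hgd : Differentiable ℂ g := fun z ↦ (hg z).differentiableAt
  have hexp : ∀ z, F z = exp (g z) := by
    have hconst : ∀ z, HasDerivAt (fun z ↦ F z * exp (-g z)) 0 z := by
      intro z
      have h : HasDerivAt (fun z ↦ F z * exp (-g z))
          (deriv F z * exp (-g z) + F z * (exp (-g z) * -(deriv F z / F z))) z :=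
        (hF z).hasDerivAt.mul (hg z).neg.cexp
      refine h.congr_deriv ?_
      field_simp [hne z]
      ring
    intro z
    have h := is_const_of_deriv_eq_zero (fun z ↦ (hconst z).differentiableAt)
      (fun z ↦ (hconst z).deriv) z 0
    simp only [hg0, exp_neg, exp_log (hne 0), mul_inv_cancel₀ (hne 0)] at h
    exact (div_eq_one_iff_eq (exp_ne_zero _)).1 h
  have hre : ∀ z, (g z).re ≤ |Real.log C| + B * ‖z‖ := by
    intro z
    have h := hbound z
    rw [hexp, norm_exp, ← Real.exp_log hC, ← Real.exp_add, Real.exp_le_exp] at h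
    linarith [le_abs_self (Real.log C)]
  -- Borel–Carathéodory on the ball of radius `2 * R` turns the bound on the real part into a bound
  -- on `‖g‖`; the `+ 1` makes the bound strictly positive.
  have hgrowth : ∀ R, 0 < R → ∀ z, ‖z‖ ≤ R →
      ‖g z‖ ≤ 2 * (|Real.log C| + 1 + B * (2 * R)) + 3 * ‖g 0‖ := by
    intro R hR z hz
    have hM : 0 < |Real.log C| + 1 + B * (2 * R) := by positivity
    have h := borelCaratheodory (R := 2 * R) (z := z) hM hgd.differentiableOn (fun x hx ↦ by
      have hx' : ‖x‖ ≤ 2 * R := (mem_ball_zero_iff.1 hx).le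
      have := mul_le_mul_of_nonneg_left hx' hB
      simp only [Set.mem_ofPred_eq]
      linarith [hre x]) (by positivity) (by rw [mem_ball_zero_iff]; linarith)
    refine h.trans (add_le_add ?_ ?_)
    · rw [div_le_iff₀ (by linarith)]
      nlinarith
    · rw [div_le_iff₀ (by linarith)]
      nlinarith [norm_nonneg (g 0)]
  -- Cauchy's estimate on a circle of radius `‖c‖ + 1`, comparable to the size of `g` there, bounds
  -- `deriv g` uniformly, so Liouville applies.
  have hderiv : ∀ c, ‖deriv g c‖ ≤ 2 * (|Real.log C| + 1 + B * 4) + 3 * ‖g 0‖ := by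
    intro c
    set R := ‖c‖ + 1
    have hR : 1 ≤ R := by simp [R]
    have h := norm_deriv_le_of_forall_mem_sphere_norm_le (c := c) (R := R)
      (C := R * (2 * (|Real.log C| + 1 + B * 4) + 3 * ‖g 0‖)) (by linarith)
      hgd.diffContOnCl (fun z hz ↦ ?_)
    · rwa [mul_div_cancel_left₀ _ (by linarith)] at h
    · have hz' : ‖z‖ ≤ 2 * R := by
        have : ‖z‖ ≤ ‖z - c‖ + ‖c‖ := by simpa using norm_add_le (z - c) c
        rw [mem_sphere_iff_norm.1 hz] at this
        linarith [show ‖c‖ = R - 1 by simp [R]]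
      refine (hgrowth (2 * R) (by linarith) z hz').trans ?_
      nlinarith [norm_nonneg (g 0), abs_nonneg (Real.log C)]
  have hconst : ∀ z, deriv g z = deriv g 0 := fun z ↦
    hgd.deriv.apply_eq_apply_of_bounded
      (isBounded_iff_forall_norm_le.2 ⟨_, by rintro _ ⟨z, rfl⟩; exact hderiv z⟩) z 0
  have hF'0 : deriv F 0 = 0 := by
    have h : deriv (fun z ↦ F (-z)) 0 = deriv F 0 := by simp only [heven]
    rw [deriv_comp_neg, neg_zero] at h
    exact self_eq_neg.1 h.symm
  refine is_const_of_deriv_eq_zero hF (fun z ↦ ?_) z 0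
  have h := hconst z
  rw [(hg z).deriv, (hg 0).deriv, hF'0, zero_div, div_eq_zero_iff] at h
  exact h.resolve_right (hne z)

-- `dslope M 0` is `M z / z` with its singularity at 0 filled in. If it had no zero it would be
-- constant and `M` linear, which `z₀` excludes.
open Complex Metric in
theorem Complex.exists_ne_zero_eq_zero_of_odd_of_norm_le_exp {M : ℂ → ℂ} (hM : Differentiable ℂ M)
    (hodd : ∀ z, M (-z) = -M z) (hM' : deriv M 0 ≠ 0) {C B : ℝ} (hB : 0 ≤ B)
    (hbound : ∀ z, ‖M z‖ ≤ C * Real.exp (B * ‖z‖)) {z₀ : ℂ} (hz₀ : deriv M z₀ ≠ deriv M 0) :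
    ∃ z, z ≠ 0 ∧ M z = 0 := by
  by_contra! hne
  have hM0 : M 0 = 0 := self_eq_neg.1 (by simpa using hodd 0)
  have hF : Differentiable ℂ (dslope M 0) := by
    rw [← differentiableOn_univ] at hM ⊢
    exact (differentiableOn_dslope Filter.univ_mem).2 hM
  have hFz : ∀ z, z ≠ 0 → dslope M 0 z = M z / z := fun z hz ↦ by
    rw [dslope_of_ne _ hz, slope_def_field, hM0, sub_zero, sub_zero]
  obtain ⟨C₀, hC₀⟩ := (isCompact_closedBall (0 : ℂ) 1).exists_bound_of_continuousOn
    hF.continuous.continuousOn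
  have hconst := eq_const_of_even_of_ne_zero_of_norm_le_exp (F := dslope M 0) hF
    (fun z ↦ by
      rcases eq_or_ne z 0 with rfl | hz
      · simp
      · rw [hFz _ hz, hFz _ (neg_ne_zero.2 hz), hodd, neg_div_neg_eq])
    (fun z ↦ by
      rcases eq_or_ne z 0 with rfl | hz
      · simpa using hM'
      · rw [hFz _ hz]
        exact div_ne_zero (hne z hz) hz)
    (C := max C C₀) hB (fun z ↦ by
      rcases le_total ‖z‖ 1 with hz | hz
      · have h := hC₀ z (by simpa using hz)
        refine (h.trans (le_max_right C C₀)).trans (le_mul_of_one_le_right ?_ ?_)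
        · exact (norm_nonneg _).trans (h.trans (le_max_right _ _))
        · exact Real.one_le_exp (by positivity)
      · rw [hFz _ (norm_pos_iff.1 (by linarith)), norm_div]
        refine (div_le_self (norm_nonneg _) hz).trans ((hbound z).trans ?_)
        gcongr
        exact le_max_left _ _)
  have hlin : M = fun z ↦ deriv M 0 * z := by
    funext z
    rcases eq_or_ne z 0 with rfl | hz
    · simp [hM0]
    · have h := hconst z
      rw [hFz z hz, dslope_same, div_eq_iff hz] at h
      exact h
  refine hz₀ ?_
  have hd : ∀ z, HasDerivAt M (deriv M 0) z := fun z ↦ by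
    rw [hlin]
    simpa using (hasDerivAt_id z).const_mul (deriv M 0)
  exact (hd z₀).deriv

theorem Complex.norm_exp_sub_one_le_norm_mul_exp (w : ℂ) :
    ‖exp w - 1‖ ≤ ‖w‖ * Real.exp ‖w‖ := by
  simpa using norm_exp_sub_sum_le_norm_mul_exp w 1

theorem Complex.norm_sinh_le_norm_mul_exp (w : ℂ) : ‖sinh w‖ ≤ ‖w‖ * Real.exp ‖w‖ := by
  have h : sinh w = ((exp w - 1) - (exp (-w) - 1)) / 2 := by rw [sinh]; ring
  have h₁ := norm_exp_sub_one_le_norm_mul_exp w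
  have h₂ := norm_exp_sub_one_le_norm_mul_exp (-w)
  rw [norm_neg] at h₂
  rw [h, norm_div, Complex.norm_ofNat, div_le_iff₀ two_pos]
  linarith [norm_sub_le (exp w - 1) (exp (-w) - 1)]

theorem Complex.norm_cosh_le_exp_norm (w : ℂ) : ‖cosh w‖ ≤ Real.exp ‖w‖ := by
  have h₁ := norm_exp_le_exp_norm w
  have h₂ := norm_exp_le_exp_norm (-w)
  rw [norm_neg] at h₂
  rw [cosh, norm_div, Complex.norm_ofNat, div_le_iff₀ two_pos]
  linarith [norm_add_le (exp w) (exp (-w))]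

/-! ### The symbol of a radial kernel and its nonzero roots. -/

namespace NonlocalGradient

theorem abs_inner_le_norm_of_norm_eq_one {E : Type*} [NormedAddCommGroup E]
    [InnerProductSpace ℝ E] {e : E} (he : ‖e‖ = 1) (z : E) :
    |inner ℝ e z| ≤ ‖z‖ := by
  simpa [he] using abs_real_inner_le_norm e z

theorem norm_mul_inner_le {E : Type*} [NormedAddCommGroup E]
    [InnerProductSpace ℝ E] {e : E} (he : ‖e‖ = 1) (l : ℂ) (z : E) :
    ‖l * (inner ℝ e z : ℝ)‖ ≤ ‖l‖ * ‖z‖ := by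
  rw [norm_mul, Complex.norm_real]
  gcongr
  exact abs_inner_le_norm_of_norm_eq_one he z

variable {E : Type*} [NormedAddCommGroup E] [InnerProductSpace ℝ E] [FiniteDimensional ℝ E]
  [MeasurableSpace E] [BorelSpace E] {δ : ℝ} {κ : E → ℝ}

/-- A nonnegative radial kernel vanishing outside `B_δ(0)` with finite second moment. -/
structure IsRadialKernel (δ : ℝ) (κ : E → ℝ) : Prop where
  nonneg : ∀ z, 0 ≤ κ z
  measurable : Measurable κ
  radial : ∀ z z', ‖z‖ = ‖z'‖ → κ z = κ z'
  eq_zero : ∀ z, δ ≤ ‖z‖ → κ z = 0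
  integrable : Integrable fun z ↦ ‖z‖ ^ 2 * κ z

/-- The symbol of the nonlocal gradient with kernel `κ` in direction `e`. -/
noncomputable def symbol (κ : E → ℝ) (e : E) (l : ℂ) : ℂ :=
  ∫ z, Complex.sinh (l * (inner ℝ e z : ℝ)) * (inner ℝ e z * κ z : ℝ)

theorem symbol_neg (κ : E → ℝ) (e : E) (l : ℂ) : symbol κ e (-l) = -symbol κ e l := by
  simp only [symbol, neg_mul, Complex.sinh_neg, integral_neg]

namespace IsRadialKernel

theorem mul_le_mul_of_lt (hκ : IsRadialKernel δ κ) {z : E} {a b : ℝ} (h : ‖z‖ < δ → a ≤ b) :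
    a * κ z ≤ b * κ z := by
  rcases lt_or_ge ‖z‖ δ with hz | hz
  · exact mul_le_mul_of_nonneg_right (h hz) (hκ.nonneg z)
  · simp [hκ.eq_zero z hz]

/-- The factors `sinh` and `⟨e, z⟩` each contribute one power of `‖z‖`, so a finite second moment is
enough. -/
theorem norm_sinh_mul_le (hκ : IsRadialKernel δ κ) {e : E} (he : ‖e‖ = 1) (l : ℂ) (z : E) :
    ‖Complex.sinh (l * (inner ℝ e z : ℝ)) * (inner ℝ e z * κ z : ℝ)‖ ≤
      ‖l‖ * Real.exp (δ * ‖l‖) * (‖z‖ ^ 2 * κ z) := by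
  rw [norm_mul, Complex.norm_real, Real.norm_eq_abs, abs_mul, abs_of_nonneg (hκ.nonneg z),
    ← mul_assoc, ← mul_assoc]
  refine hκ.mul_le_mul_of_lt fun hz ↦ ?_
  have h₁ := norm_mul_inner_le he l z
  have h₂ := abs_inner_le_norm_of_norm_eq_one he z
  calc _ ≤ (‖l‖ * ‖z‖ * Real.exp (‖l‖ * δ)) * ‖z‖ := by
        refine mul_le_mul ((Complex.norm_sinh_le_norm_mul_exp _).trans ?_) h₂ (abs_nonneg _)
          (by positivity)
        have := h₁.trans (mul_le_mul_of_nonneg_left hz.le (norm_nonneg l))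
        gcongr
    _ = _ := by rw [mul_comm ‖l‖ δ]; ring

theorem norm_cosh_mul_le (hκ : IsRadialKernel δ κ) {e : E} (he : ‖e‖ = 1) (l : ℂ) (z : E) :
    ‖Complex.cosh (l * (inner ℝ e z : ℝ)) * (inner ℝ e z ^ 2 * κ z : ℝ)‖ ≤
      Real.exp (δ * ‖l‖) * (‖z‖ ^ 2 * κ z) := by
  rw [norm_mul, Complex.norm_real, Real.norm_eq_abs, abs_mul, abs_of_nonneg (hκ.nonneg z),
    ← mul_assoc, ← mul_assoc, abs_pow]
  refine hκ.mul_le_mul_of_lt fun hz ↦ ?_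
  have h₁ := norm_mul_inner_le he l z
  have h₂ := abs_inner_le_norm_of_norm_eq_one he z
  gcongr
  refine (Complex.norm_cosh_le_exp_norm _).trans (Real.exp_le_exp.2 (h₁.trans ?_))
  rw [mul_comm]
  gcongr

theorem norm_symbol_le (hκ : IsRadialKernel δ κ) {e : E} (he : ‖e‖ = 1) (l : ℂ) :
    ‖symbol κ e l‖ ≤ (∫ z, ‖z‖ ^ 2 * κ z) * Real.exp ((δ + 1) * ‖l‖) := by
  have h := norm_integral_le_of_norm_le (hκ.integrable.const_mul _)
    (Filter.Eventually.of_forall (hκ.norm_sinh_mul_le he l))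
  refine h.trans ?_
  rw [integral_const_mul, mul_comm]
  refine mul_le_mul_of_nonneg_left ?_
    (integral_nonneg fun z ↦ mul_nonneg (by positivity) (hκ.nonneg z))
  -- The extra 1 in the exponent absorbs the factor `‖l‖`.
  rw [add_mul, one_mul, Real.exp_add, mul_comm]
  gcongr
  linarith [Real.add_one_le_exp ‖l‖]

theorem hasDerivAt_symbol (hκ : IsRadialKernel δ κ) (hδ : 0 ≤ δ) {e : E} (he : ‖e‖ = 1) (l : ℂ) :
    HasDerivAt (symbol κ e)
      (∫ z, Complex.cosh (l * (inner ℝ e z : ℝ)) * (inner ℝ e z ^ 2 * κ z : ℝ)) l := by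
  have hm := hκ.measurable
  refine (hasDerivAt_integral_of_dominated_loc_of_deriv_le
    (F := fun l z ↦ Complex.sinh (l * (inner ℝ e z : ℝ)) * (inner ℝ e z * κ z : ℝ))
    (F' := fun l z ↦ Complex.cosh (l * (inner ℝ e z : ℝ)) * (inner ℝ e z ^ 2 * κ z : ℝ))
    (bound := fun z ↦ Real.exp (δ * (‖l‖ + 1)) * (‖z‖ ^ 2 * κ z))
    (Metric.ball_mem_nhds l one_pos) ?_ ?_ ?_ ?_ ?_ ?_).2
  · exact Filter.Eventually.of_forall fun l ↦ (by fun_prop : Measurable _).aestronglyMeasurable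
  · exact (hκ.integrable.const_mul _).mono' (by fun_prop : Measurable _).aestronglyMeasurable
      (Filter.Eventually.of_forall (hκ.norm_sinh_mul_le he l))
  · exact (by fun_prop : Measurable _).aestronglyMeasurable
  · refine Filter.Eventually.of_forall fun z l' hl' ↦ (hκ.norm_cosh_mul_le he l' z).trans ?_
    have hl : ‖l'‖ ≤ ‖l‖ + 1 := by
      have := norm_add_le (l' - l) l
      rw [sub_add_cancel] at this
      linarith [mem_ball_iff_norm.1 hl']
    have := hκ.nonneg z
    gcongr
  · exact hκ.integrable.const_mul _
  · refine Filter.Eventually.of_forall fun z l' _ ↦ ?_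
    have h := (((hasDerivAt_id l').mul_const ((inner ℝ e z : ℝ) : ℂ)).csinh).mul_const
      ((inner ℝ e z * κ z : ℝ) : ℂ)
    refine h.congr_deriv ?_
    push_cast [id]
    ring

theorem integrable_cosh (hκ : IsRadialKernel δ κ) {e : E} (he : ‖e‖ = 1) (t : ℝ) :
    Integrable fun z ↦ Real.cosh (t * inner ℝ e z) * (inner ℝ e z ^ 2 * κ z) := by
  have hm := hκ.measurable
  refine (hκ.integrable.const_mul (Real.exp (δ * |t|))).mono'
    (by fun_prop : Measurable _).aestronglyMeasurable (Filter.Eventually.of_forall fun z ↦ ?_)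
  have h := hκ.norm_cosh_mul_le he t z
  rwa [← Complex.ofReal_mul, ← Complex.ofReal_cosh, ← Complex.ofReal_mul, Complex.norm_real,
    Complex.norm_real] at h

theorem deriv_symbol_ofReal (hκ : IsRadialKernel δ κ) (hδ : 0 ≤ δ) {e : E} (he : ‖e‖ = 1) (t : ℝ) :
    deriv (symbol κ e) t =
      (∫ z, Real.cosh (t * inner ℝ e z) * (inner ℝ e z ^ 2 * κ z) : ℝ) := by
  rw [(hκ.hasDerivAt_symbol hδ he t).deriv, ← integral_complex_ofReal]
  simp

theorem integral_pos_of_pos (hκ : IsRadialKernel δ κ) {r : ℝ} (hr : 0 < r)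
    (hpos : ∀ z, z ≠ 0 → ‖z‖ < r → 0 < κ z) {e : E} (he : ‖e‖ = 1) {f : E → ℝ}
    (hf : Integrable fun z ↦ f z * (inner ℝ e z ^ 2 * κ z)) (hf0 : ∀ z, 0 ≤ f z)
    (hfpos : ∀ z, inner ℝ e z ≠ 0 → 0 < f z) :
    0 < ∫ z, f z * (inner ℝ e z ^ 2 * κ z) := by
  rw [integral_pos_iff_support_of_nonneg
    (fun z ↦ mul_nonneg (hf0 z) (mul_nonneg (sq_nonneg _) (hκ.nonneg z))) hf]
  set V : Set E := {z | inner ℝ e z ≠ 0} ∩ Metric.ball 0 r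
  have hV : IsOpen V := (isOpen_ne_fun (by fun_prop) continuous_const).inter Metric.isOpen_ball
  have hVne : V.Nonempty := by
    refine ⟨(r / 2) • e, ?_, ?_⟩
    · simp [inner_smul_right, he, hr.ne']
    · simp [norm_smul, he, abs_of_pos hr, hr]
  refine (hV.measure_pos volume hVne).trans_le (measure_mono fun z hz ↦ ?_)
  have hz0 : z ≠ 0 := fun h ↦ hz.1 (by simp [h])
  exact mul_ne_zero (hfpos z hz.1).ne'
    (mul_ne_zero (pow_ne_zero 2 hz.1) (hpos z hz0 (by simpa using hz.2)).ne')

theorem exists_symbol_eq_zero (hκ : IsRadialKernel δ κ) (hδ : 0 ≤ δ) {r : ℝ} (hr : 0 < r)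
    (hpos : ∀ z, z ≠ 0 → ‖z‖ < r → 0 < κ z) {e : E} (he : ‖e‖ = 1) :
    ∃ l, l ≠ 0 ∧ symbol κ e l = 0 := by
  have h₀ := hκ.integrable_cosh he 0
  have h₁ := hκ.integrable_cosh he 1
  have hd₀ := hκ.deriv_symbol_ofReal hδ he 0
  have hd₁ := hκ.deriv_symbol_ofReal hδ he 1
  refine Complex.exists_ne_zero_eq_zero_of_odd_of_norm_le_exp
    (fun l ↦ (hκ.hasDerivAt_symbol hδ he l).differentiableAt) (symbol_neg κ e) ?_
    (by linarith : 0 ≤ δ + 1) (hκ.norm_symbol_le he) (z₀ := (1 : ℝ)) ?_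
  · rw [← Complex.ofReal_zero, hd₀, Ne, Complex.ofReal_inj]
    exact (hκ.integral_pos_of_pos hr hpos he h₀ (fun z ↦ (Real.cosh_pos _).le)
      fun z _ ↦ Real.cosh_pos _).ne'
  -- The difference of the derivatives integrates `cosh ⟨e, z⟩ - 1`, positive off the hyperplane
  -- `⟨e, z⟩ = 0`.
  · rw [← Complex.ofReal_zero, hd₀, hd₁, Ne, Complex.ofReal_inj, ← sub_eq_zero,
      ← integral_sub h₁ h₀]
    simp only [← sub_mul]
    refine (hκ.integral_pos_of_pos hr hpos he ?_ (fun z ↦ ?_) fun z hz ↦ ?_).ne'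
    · simpa only [sub_mul] using! h₁.sub h₀
    · simp
    · simpa using hz

/-! ### Testing exponentials against the nonlocal divergence. -/

theorem integrable_one_sub_exp_mul (hκ : IsRadialKernel δ κ) {e : E} (he : ‖e‖ = 1) (l : ℂ)
    (L : E →L[ℝ] ℂ) :
    Integrable fun z ↦ (1 - Complex.exp (l * (inner ℝ e z : ℝ))) * (κ z * L z) := by
  have hm := hκ.measurable
  refine (hκ.integrable.const_mul (‖l‖ * Real.exp (‖l‖ * δ) * ‖L‖)).mono'
    (by fun_prop : Measurable _).aestronglyMeasurable (Filter.Eventually.of_forall fun z ↦ ?_)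
  rw [norm_mul, norm_mul, Complex.norm_real, Real.norm_eq_abs, abs_of_nonneg (hκ.nonneg z),
    mul_left_comm, mul_comm, ← mul_assoc _ _ (κ z)]
  refine hκ.mul_le_mul_of_lt fun hz ↦ ?_
  have h₁ := norm_mul_inner_le he l z
  have h₂ := h₁.trans (mul_le_mul_of_nonneg_left hz.le (norm_nonneg l))
  rw [norm_sub_rev]
  calc _ ≤ (‖l‖ * ‖z‖ * Real.exp (‖l‖ * δ)) * (‖L‖ * ‖z‖) := by
        refine mul_le_mul ((Complex.norm_exp_sub_one_le_norm_mul_exp _).trans ?_)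
          (L.le_opNorm z) (norm_nonneg _) (by positivity)
        gcongr
    _ = _ := by ring

/-- Averaging the integrand over `z` and `-z` leaves only the `sinh` part. -/
theorem integral_one_sub_exp_mul_inner (hκ : IsRadialKernel δ κ) {e : E} (he : ‖e‖ = 1) (l : ℂ) :
    ∫ z, (1 - Complex.exp (l * (inner ℝ e z : ℝ))) * (κ z * (inner ℝ e z : ℝ)) =
      -symbol κ e l := by
  set L : E →L[ℝ] ℂ := Complex.ofRealCLM.comp (innerSL ℝ e)
  have hi := hκ.integrable_one_sub_exp_mul he l L
  have hi' := hi.comp_neg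
  have hneg := integral_neg_eq_self
    (fun z ↦ (1 - Complex.exp (l * (inner ℝ e z : ℝ))) * (κ z * L z)) volume
  have h2 := integral_add hi hi'
  rw [hneg] at h2
  simp only [L, ContinuousLinearMap.comp_apply, innerSL_apply_apply, Complex.ofRealCLM_apply,
    inner_neg_right, hκ.radial (-_) _ (norm_neg _)] at h2
  rw [← mul_right_inj' (two_ne_zero (α := ℂ)), two_mul, ← h2, symbol, ← integral_neg,
    ← integral_const_mul]
  congr 1 with z
  rw [Complex.sinh]
  push_cast
  rw [mul_neg]
  ring

/-- By symmetry across the line spanned by `e`, only the component of `L` along `e` contributes. -/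
theorem integral_one_sub_exp_mul (hκ : IsRadialKernel δ κ) {e : E} (he : ‖e‖ = 1) (l : ℂ)
    (L : E →L[ℝ] ℂ) :
    ∫ z, (1 - Complex.exp (l * (inner ℝ e z : ℝ))) * (κ z * L z) = -(L e * symbol κ e l) := by
  set R := (ℝ ∙ e).reflection
  have hR : ∀ z, R z = (2 * inner ℝ e z) • e - z := fun z ↦ by
    simp only [R, Submodule.reflection_singleton_apply, he]
    simp [mul_smul, two_smul]
  have hRe : ∀ z, inner ℝ e (R z) = inner ℝ e z := fun z ↦ by
    rw [hR, inner_sub_right, inner_smul_right, real_inner_self_eq_norm_sq, he]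
    ring
  have hi := hκ.integrable_one_sub_exp_mul he l L
  have hi' := (R.measurePreserving.integrable_comp_emb R.toMeasurableEquiv.measurableEmbedding).2 hi
  have hrefl := R.measurePreserving.integral_comp R.toMeasurableEquiv.measurableEmbedding
    (fun z ↦ (1 - Complex.exp (l * (inner ℝ e z : ℝ))) * (κ z * L z))
  have h2 := integral_add hi hi'
  simp only [Function.comp_apply] at h2
  rw [hrefl] at h2
  -- Since `z + R z = 2⟨e, z⟩ e`, averaging over `R` replaces `L z` by `⟨e, z⟩ L e`.
  rw [← mul_right_inj' (two_ne_zero (α := ℂ)), two_mul, ← h2, ← mul_neg,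
    ← hκ.integral_one_sub_exp_mul_inner he, ← integral_const_mul, ← integral_const_mul]
  congr 1 with z
  rw [hRe, hκ.radial (R z) z (R.norm_map z), hR, map_sub, map_smul, Complex.real_smul]
  push_cast
  ring

/-- Integrability of the double integral behind the nonlocal divergence. -/
theorem integrable_prod_mul_inner_sub (hκ : IsRadialKernel δ κ) (hδ : 0 ≤ δ) {ψ : E → E}
    {C : NNReal} (hψ : LipschitzWith C ψ) (hψc : HasCompactSupport ψ) {u : E → ℂ}
    (hu : Continuous u) :
    Integrable (fun q : E × E ↦ u q.1 * (inner ℝ (ψ q.1 - ψ (q.1 - q.2)) q.2 * κ q.2 : ℝ)) := by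
  have hm := hκ.measurable
  have hψm := hψ.continuous
  obtain ⟨R, hR⟩ := hψc.isCompact.isBounded.subset_closedBall (0 : E)
  set T := Metric.closedBall (0 : E) (R + δ)
  obtain ⟨A, hA⟩ := (isCompact_closedBall (0 : E) (R + δ)).exists_bound_of_continuousOn
    hu.continuousOn
  have hT : Integrable (T.indicator fun _ ↦ |A| * C) :=
    (integrable_indicator_iff Metric.isClosed_closedBall.measurableSet).2
      (integrableOn_const (isCompact_closedBall _ _).measure_lt_top.ne)
  refine (hT.mul_prod hκ.integrable).mono' (by fun_prop : Measurable _).aestronglyMeasurable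
    (Filter.Eventually.of_forall fun ⟨x, z⟩ ↦ ?_)
  rw [norm_mul, Complex.norm_real, Real.norm_eq_abs, abs_mul, abs_of_nonneg (hκ.nonneg z),
    ← mul_assoc, ← mul_assoc]
  refine hκ.mul_le_mul_of_lt fun hz ↦ ?_
  by_cases hx : x ∈ T
  · rw [Set.indicator_of_mem hx]
    have h := hψ.norm_sub_le x (x - z)
    rw [sub_sub_cancel] at h
    calc _ ≤ |A| * ((C * ‖z‖) * ‖z‖) := by
          refine mul_le_mul ((hA x hx).trans (le_abs_self A)) ?_ (abs_nonneg _) (abs_nonneg _)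
          exact (abs_real_inner_le_norm _ _).trans (by gcongr)
      _ = _ := by ring
  -- For `x` outside `T` and `‖z‖ < δ`, both `x` and `x - z` miss the support of `ψ`.
  · have hx' : R + δ < ‖x‖ := by simpa [T] using hx
    have hψ0 : ∀ y, R < ‖y‖ → ψ y = 0 := fun y hy ↦
      image_eq_zero_of_notMem_tsupport fun h ↦ by
        have := hR h
        rw [mem_closedBall_zero_iff] at this
        linarith
    have hxz : R < ‖x - z‖ := by linarith [norm_sub_norm_le x z]
    simp [Set.indicator_of_notMem hx, hψ0 x (by linarith), hψ0 _ hxz]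

/-- After Fubini, translating `x` by `z` moves the difference from `ψ` to the exponential and yields
the factor `1 - exp (l⟨e, z⟩)`. The remaining integral in `z` is a multiple of the symbol. -/
theorem integral_exp_mul_integral_eq_zero (hκ : IsRadialKernel δ κ) (hδ : 0 ≤ δ) {ψ : E → E}
    {C : NNReal} (hψ : LipschitzWith C ψ) (hψc : HasCompactSupport ψ) {e : E} (he : ‖e‖ = 1)
    {l : ℂ} (hl : symbol κ e l = 0) :
    ∫ x, Complex.exp (l * (inner ℝ e x : ℝ)) *
      (∫ z, inner ℝ (ψ x - ψ (x - z)) z * κ z : ℝ) = 0 := by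
  set u : E → ℂ := fun x ↦ Complex.exp (l * (inner ℝ e x : ℝ)) with hu_def
  have hu : Continuous u := by fun_prop
  have hψm := hψ.continuous
  have hint := hκ.integrable_prod_mul_inner_sub hδ hψ hψc hu
  have hiΨ : Integrable fun x ↦ u x • Complex.ofRealCLM.comp (innerSL ℝ (ψ x)) := by
    refine Continuous.integrable_of_hasCompactSupport
      (hu.smul (continuous_const.clm_comp ((innerSL ℝ).continuous.comp hψm))) ?_
    exact hψc.mono fun x hx h ↦ hx (by simp only [h, map_zero]; ext; simp)
  set L : E →L[ℝ] ℂ := ∫ x, u x • Complex.ofRealCLM.comp (innerSL ℝ (ψ x))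
  have hL : ∀ v, L v = ∫ x, u x * (inner ℝ (ψ x) v : ℝ) := fun v ↦ by
    simp only [L, ContinuousLinearMap.integral_apply hiΨ]
    rfl
  have hi : ∀ v z, Integrable fun x ↦ u (x + z) * (inner ℝ (ψ x) v : ℝ) := fun v z ↦ by
    refine Continuous.integrable_of_hasCompactSupport (by fun_prop) ?_
    exact hψc.mono fun x hx h ↦ hx (by simp [h])
  have hinner : ∀ z, ∫ x, u x * (inner ℝ (ψ x - ψ (x - z)) z * κ z : ℝ) =
      (1 - Complex.exp (l * (inner ℝ e z : ℝ))) * (κ z * L z) := fun z ↦ by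
    have h₁ : Integrable fun x ↦ u x * (inner ℝ (ψ x) z : ℝ) := by simpa using hi z 0
    have h₂ : Integrable fun x ↦ u x * (inner ℝ (ψ (x - z)) z : ℝ) := by
      simpa using (hi z z).comp_sub_right z
    have h₃ : ∫ x, u x * (inner ℝ (ψ (x - z)) z : ℝ) =
        Complex.exp (l * (inner ℝ e z : ℝ)) * L z := by
      have h := integral_sub_right_eq_self (fun x ↦ u (x + z) * ((inner ℝ (ψ x) z : ℝ) : ℂ))
        (μ := volume) z
      simp only [sub_add_cancel] at h
      rw [h, hL, ← integral_const_mul]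
      congr 1 with x
      simp only [hu_def, inner_add_right, Complex.ofReal_add, mul_add, Complex.exp_add]
      ring
    have h₄ := integral_sub h₁ h₂
    rw [h₃, ← hL] at h₄
    rw [← one_sub_mul] at h₄
    rw [mul_left_comm, ← h₄, ← integral_const_mul]
    congr 1 with x
    rw [inner_sub_left]
    push_cast
    ring
  have hpull : ∀ x, u x * ((∫ z, inner ℝ (ψ x - ψ (x - z)) z * κ z : ℝ) : ℂ) =
      ∫ z, u x * (inner ℝ (ψ x - ψ (x - z)) z * κ z : ℝ) := fun x ↦ by
    rw [integral_const_mul, integral_complex_ofReal]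
  refine (integral_congr_ae (Filter.Eventually.of_forall hpull)).trans ?_
  rw [integral_integral_swap hint]
  simp only [hinner]
  rw [hκ.integral_one_sub_exp_mul he, hl, mul_zero, neg_zero]

end IsRadialKernel

/-! ### The kernel of the nonlocal gradient and its exponential null functions. -/

variable {n : ℕ} {s δ : ℝ} {w : EuclideanSpace ℝ (Fin n) → ℝ}

/-- The scalar kernel `w(z) / |z|^(n+s+1)` appearing in the nonlocal divergence. -/
noncomputable def scalarKernel (s : ℝ) (w : EuclideanSpace ℝ (Fin n) → ℝ)
    (z : EuclideanSpace ℝ (Fin n)) : ℝ :=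
  ‖z‖⁻¹ ^ 2 * (w z / ‖z‖ ^ ((n : ℝ) + s - 1))

theorem IsCutoff.isRadialKernel_scalarKernel (hw : IsCutoff δ w) (hn : 1 ≤ n) (hs : s < 1) :
    IsRadialKernel δ (scalarKernel s w) := by
  obtain ⟨wbar, hwbar, hwz⟩ := hw.radial
  have hw0 : ∀ z, 0 ≤ w z := fun z ↦ by rw [hwz]; exact hwbar _
  have hwm : Measurable w := hw.smooth.continuous.measurable
  have hwδ : ∀ z, δ ≤ ‖z‖ → w z = 0 := fun z hz ↦
    image_eq_zero_of_notMem_tsupport fun h ↦ by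
      have := mem_ball_zero_iff.1 (hw.tsupport_subset h)
      linarith
  have hm : Measurable (scalarKernel s w) := by
    unfold scalarKernel
    fun_prop
  refine ⟨fun z ↦ ?_, hm, fun z z' h ↦ ?_, fun z hz ↦ ?_, ?_⟩
  · have := hw0 z
    unfold scalarKernel
    positivity
  · simp only [scalarKernel, hwz, h]
  · simp [scalarKernel, hwδ z hz]
  · obtain ⟨A, hA⟩ := hw.hasCompactSupport.exists_bound_of_continuous hw.smooth.continuous
    have h : IntegrableOn (fun z : EuclideanSpace ℝ (Fin n) ↦ ‖z‖ ^ 2 * scalarKernel s w z)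
        (Metric.ball 0 δ) := by
      -- The second moment density is at most `A * ‖z‖ ^ (-(n + s - 1))`, integrable near 0 because
      -- `s < 1`.
      refine integrableOn_ball_of_norm_le_rpow (C := A) (α := (n : ℝ) + s - 1) (by simpa) ?_
        (ae_restrict_of_ae (Filter.Eventually.of_forall fun z ↦ ?_))
        (by fun_prop : Measurable _).aestronglyMeasurable
      · simp only [finrank_euclideanSpace, Fintype.card_fin]
        linarith
      · have hA0 : 0 ≤ A := (norm_nonneg _).trans (hA z)
        rcases eq_or_ne z 0 with rfl | hz
        · simp only [norm_zero, ne_eq, OfNat.ofNat_ne_zero, not_false_eq_true, zero_pow, zero_mul]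
          positivity
        · have hz' : ‖z‖ ≠ 0 := norm_ne_zero_iff.2 hz
          rw [scalarKernel, ← mul_assoc, ← mul_pow, mul_inv_cancel₀ hz', one_pow, one_mul,
            norm_div, Real.norm_of_nonneg (Real.rpow_nonneg (norm_nonneg z) _),
            Real.rpow_neg (norm_nonneg z), div_eq_mul_inv]
          gcongr
          exact hA z
    rwa [integrableOn_iff_integrable_of_support_subset] at h
    intro z hz
    by_contra hzδ
    rw [mem_ball_zero_iff, not_lt] at hzδ
    exact hz (by simp [scalarKernel, hwδ z hzδ])

theorem IsCutoff.exists_scalarKernel_pos (hw : IsCutoff δ w) (hδ : 0 < δ) :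
    ∃ r, 0 < r ∧ ∀ z, z ≠ 0 → ‖z‖ < r → 0 < scalarKernel s w z := by
  obtain ⟨μ, hμ, -, h⟩ := hw.normalized
  refine ⟨μ * δ, by positivity, fun z hz hzr ↦ ?_⟩
  have := norm_pos_iff.2 hz
  rw [scalarKernel, h z (by simpa using hzr)]
  positivity

theorem nonlocalDiv_eq (s δ : ℝ) (w : EuclideanSpace ℝ (Fin n) → ℝ)
    (ψ : EuclideanSpace ℝ (Fin n) → EuclideanSpace ℝ (Fin n)) (x : EuclideanSpace ℝ (Fin n)) :
    nonlocalDiv s δ w ψ x =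
      scalingConst s δ w * ∫ z, inner ℝ (ψ x - ψ (x - z)) z * scalarKernel s w z := by
  rw [nonlocalDiv, ← integral_const_mul, ← integral_sub_left_eq_self _ _ x]
  congr 1 with z
  simp only [sub_sub_cancel, kernel, scalarKernel, real_inner_smul_left, real_inner_smul_right]
  ring

/-- Allows integrals over the thickening to be extended to the whole space, where translation
invariance is available. -/
theorem IsCutoff.nonlocalDiv_eq_zero (hw : IsCutoff δ w) (hn : 1 ≤ n) (hs : s < 1) (hδ : 0 < δ)
    {Ω : Set (EuclideanSpace ℝ (Fin n))}
    {ψ : EuclideanSpace ℝ (Fin n) → EuclideanSpace ℝ (Fin n)} (hψ : tsupport ψ ⊆ Ω)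
    {x : EuclideanSpace ℝ (Fin n)} (hx : x ∉ Metric.thickening δ Ω) :
    nonlocalDiv s δ w ψ x = 0 := by
  have hψ0 : ∀ y ∉ Ω, ψ y = 0 := fun y hy ↦ image_eq_zero_of_notMem_tsupport fun h ↦ hy (hψ h)
  rw [nonlocalDiv_eq, integral_eq_zero_of_ae, mul_zero]
  refine Filter.Eventually.of_forall fun z ↦ ?_
  rcases lt_or_ge ‖z‖ δ with hz | hz
  · have hxz : x - z ∉ Ω := fun h ↦ hx (Metric.mem_thickening_iff.2 ⟨_, h, by simpa⟩)
    simp [hψ0 _ hxz, hψ0 x fun h ↦ hx (Metric.self_subset_thickening hδ Ω h)]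
  · simp [(hw.isRadialKernel_scalarKernel (s := s) hn hs).eq_zero z hz]

/-- Complex exponentials at a zero of the symbol have zero nonlocal gradient. -/
theorem IsCutoff.re_exp_mem_zeroNonlocalGrad (hw : IsCutoff δ w) (hn : 1 ≤ n) (hs : s < 1)
    (hδ : 0 < δ) {Ω : Set (EuclideanSpace ℝ (Fin n))} (hΩ : Bornology.IsBounded Ω) (p : ℝ≥0∞)
    {e : EuclideanSpace ℝ (Fin n)} (he : ‖e‖ = 1) {l : ℂ}
    (hl : symbol (scalarKernel s w) e l = 0) (a : ℂ) :
    (fun x ↦ (a * Complex.exp (l * (inner ℝ e x : ℝ))).re) ∈ zeroNonlocalGrad s p δ w Ω := by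
  have hκ := hw.isRadialKernel_scalarKernel (s := s) hn hs
  set h : EuclideanSpace ℝ (Fin n) → ℝ :=
    fun x ↦ (a * Complex.exp (l * (inner ℝ e x : ℝ))).re with hh
  have hc : Continuous h := by fun_prop
  have hgrad : IsWeakNonlocalGrad s δ w Ω h 0 := by
    refine ⟨hc.locallyIntegrable.locallyIntegrableOn _, locallyIntegrableOn_zero, ?_⟩
    intro ψ hψ hψc hψΩ
    obtain ⟨C, hC⟩ := hψ.lipschitzWith_of_hasCompactSupport hψc (by simp)
    simp only [Pi.zero_apply, inner_zero_left, integral_zero]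
    rw [eq_comm, neg_eq_zero, setIntegral_eq_integral_of_forall_compl_eq_zero fun x hx ↦ by
      rw [hw.nonlocalDiv_eq_zero hn hs hδ hψΩ hx, mul_zero]]
    have hint := (hκ.integrable_prod_mul_inner_sub hδ.le hC hψc (u := fun x ↦
      Complex.exp (l * (inner ℝ e x : ℝ))) (by fun_prop)).integral_prod_left
    simp only [integral_const_mul, integral_complex_ofReal] at hint
    -- The nonlocal divergence is real, so the wanted integral is the real part of a complex one
    -- that vanishes.
    have hre := integral_re (hint.const_mul (a * scalingConst s δ w))
    rw [integral_const_mul, hκ.integral_exp_mul_integral_eq_zero hδ.le hC hψc he hl, mul_zero,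
      map_zero] at hre
    rw [← hre]
    congr 1 with x
    rw [nonlocalDiv_eq, hh, RCLike.re_eq_complex_re, ← Complex.re_mul_ofReal]
    congr 1
    push_cast
    ring
  have hmem : MemLp h p (volume.restrict (Metric.thickening δ Ω)) := by
    have hb : Bornology.IsBounded (Metric.thickening δ Ω) := hΩ.thickening
    obtain ⟨A, hA⟩ := hb.isCompact_closure.exists_bound_of_continuousOn hc.continuousOn
    have : IsFiniteMeasure (volume.restrict (Metric.thickening δ Ω)) :=
      ⟨by simpa using hb.measure_lt_top⟩
    refine MemLp.of_bound hc.aestronglyMeasurable A ?_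
    filter_upwards [ae_restrict_mem Metric.isOpen_thickening.measurableSet] with x hx
    exact hA x (subset_closure hx)
  exact ⟨⟨hmem, 0, hgrad, MemLp.zero⟩, 0, hgrad, by simp⟩

/-- The derivative in direction `e` is `l` times the exponential, which never vanishes. -/
theorem not_forall_exp_inner_eq {e : EuclideanSpace ℝ (Fin n)} (he : ‖e‖ = 1) {l : ℂ} (hl : l ≠ 0)
    {U : Set (EuclideanSpace ℝ (Fin n))} (hU : IsOpen U) (hne : U.Nonempty) (c : ℂ) :
    ¬ ∀ x ∈ U, Complex.exp (l * (inner ℝ e x : ℝ)) = c := by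
  intro h
  obtain ⟨x, hx⟩ := hne
  have hd : HasDerivAt (fun t : ℝ ↦ Complex.exp (l * (inner ℝ e (x + t • e) : ℝ)))
      (Complex.exp (l * (inner ℝ e x : ℝ)) * l) 0 := by
    have h₁ : HasDerivAt (fun t : ℝ ↦ l * ((inner ℝ e x + t : ℝ) : ℂ)) l 0 := by
      simpa using! (((hasDerivAt_id (0 : ℝ)).const_add (inner ℝ e x)).ofReal_comp).const_mul l
    have h₂ := h₁.cexp
    simpa [inner_add_right, inner_smul_right, he] using! h₂
  have hev : (fun t : ℝ ↦ Complex.exp (l * (inner ℝ e (x + t • e) : ℝ))) =ᶠ[nhds 0] fun _ ↦ c := by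
    have hcont : ContinuousAt (fun t : ℝ ↦ x + t • e) 0 := by fun_prop
    filter_upwards [hcont.preimage_mem_nhds (hU.mem_nhds (by simpa))] with t ht
    exact h _ ht
  have h0 := hd.unique ((hasDerivAt_const (0 : ℝ) c).congr_of_eventuallyEq hev)
  exact mul_ne_zero (Complex.exp_ne_zero _) hl h0

end NonlocalGradient

theorem proposition3p1 {n : ℕ} (hn : 1 ≤ n) (s δ : ℝ) (hs0 : 0 < s) (hs1 : s < 1) (hδ : 0 < δ)
    (w : EuclideanSpace ℝ (Fin n) → ℝ) (hw : NonlocalGradient.IsCutoff δ w)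
    (Ω : Set (EuclideanSpace ℝ (Fin n))) (hΩo : IsOpen Ω) (hΩb : Bornology.IsBounded Ω)
    (p : ℝ≥0∞) (hp : 1 ≤ p)
    (U : Set (EuclideanSpace ℝ (Fin n))) (hUo : IsOpen U) (hUne : U.Nonempty) (hUΩ : U ⊆ Ω) :
    ¬ (NonlocalGradient.zeroNonlocalGrad s p δ w Ω ⊆
      {u | u ∈ NonlocalGradient.nonlocalSobolev s p δ w Ω ∧
        ∃ c : ℝ, ∀ᵐ x ∂(volume.restrict U), u x = c}) := by
  intro hsub
  set e : EuclideanSpace ℝ (Fin n) := EuclideanSpace.single ⟨0, hn⟩ 1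
  have he : ‖e‖ = 1 := by simp [e]
  obtain ⟨r, hr, hpos⟩ := hw.exists_scalarKernel_pos (s := s) hδ
  obtain ⟨l, hl, hl0⟩ := (hw.isRadialKernel_scalarKernel (s := s) hn hs1).exists_symbol_eq_zero
    hδ.le hr hpos he
  have hconst : ∀ a : ℂ, ∃ c : ℝ, ∀ x ∈ U, (a * Complex.exp (l * (inner ℝ e x : ℝ))).re = c := by
    intro a
    obtain ⟨-, c, hc⟩ := hsub (hw.re_exp_mem_zeroNonlocalGrad hn hs1 hδ hΩb p he hl0 a)
    exact ⟨c, Measure.eqOn_open_of_ae_eq (g := fun _ ↦ c) hc hUo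
      (Continuous.continuousOn (by fun_prop)) continuousOn_const⟩
  -- The coefficients `1` and `-I` select the real and imaginary parts of the exponential.
  obtain ⟨c₁, hc₁⟩ := hconst 1
  obtain ⟨c₂, hc₂⟩ := hconst (-Complex.I)
  refine NonlocalGradient.not_forall_exp_inner_eq he hl hUo hUne ⟨c₁, c₂⟩ fun x hx ↦ ?_
  apply Complex.ext
  · simpa using hc₁ x hx
  · simpa using hc₂ x hx
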